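/- Let $\mathbb P=\{1,2,3,\dots\}$. Two words over $\mathbb P$ are Knuth-equivalent, written $v\equiv w$, if one can be obtained from the other by a finite sequence of Knuth transpositions, that is, exchanges $xacby\leftrightarrow xcaby$ with $a\le b<c$, or $xbacy\leftrightarrow xbcay$ with $a<b\le c$, where $x,y$ are words and $a,b,c\in\mathbb P$. For a word $u$ over $\mathbb P$ let $$C(u)=\{w\in\mathbb P^* \mid uw\equiv wu\},$$ and for integers $n,m\ge 0$ let $c_{n,m}(u)$ be the number of words $w\in C(u)$ of length $n$ all of whose letters are at most $m$. Theorem. Let $n,m\ge 0$ be integers and let $u\in\mathbb P$, regarded also as a word of length $1$. Then $$c_{n,m}(u)=\begin{cases} c_{n,m}(1) & \text{if } u\le m,\\ \delta_{n,0} & \text{if } u>m,\end{cases}$$ where $\delta_{n,0}=1$ if $n=0$ and $\delta_{n,0}=0$ otherwise. -/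

import Mathlib

/-- `v` and `w` differ by an elementary Knuth transposition (oriented): either
`v = x a c b y`, `w = x c a b y` with `a ≤ b < c`, or
`v = x b a c y`, `w = x b c a y` with `a < b ≤ c`. -/
inductive KnuthTransposition : List ℕ+ → List ℕ+ → Prop
  | acb (x y : List ℕ+) (a b c : ℕ+) (hab : a ≤ b) (hbc : b < c) :
      KnuthTransposition (x ++ [a, c, b] ++ y) (x ++ [c, a, b] ++ y)
  | bac (x y : List ℕ+) (a b c : ℕ+) (hab : a < b) (hbc : b ≤ c) :
      KnuthTransposition (x ++ [b, a, c] ++ y) (x ++ [b, c, a] ++ y)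

/-- Knuth equivalence of words: one word is obtained from the other by a finite sequence of
Knuth transpositions, each applied in either direction. -/
def KnuthEquiv (v w : List ℕ+) : Prop :=
  Relation.EqvGen KnuthTransposition v w

/-- The centralizer `C(u)` of the word `u`: all words `w` with `uw` Knuth-equivalent to `wu`. -/
def placticCentralizer (u : List ℕ+) : Set (List ℕ+) :=
  {w | KnuthEquiv (u ++ w) (w ++ u)}

/-- The words of `C(u)` of length `n` with maximum at most `m`
(the empty word has maximum at most every `m`). -/
def boundedCentralizer (n m : ℕ) (u : List ℕ+) : Set (List ℕ+) :=
  {w | w ∈ placticCentralizer u ∧ w.length = n ∧ ∀ i ∈ w, (i : ℕ) ≤ m}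

/-- The set being counted is finite, so its `Set.ncard` is its true number of elements. -/
theorem boundedCentralizer_finite (n m : ℕ) (u : List ℕ+) :
    (boundedCentralizer n m u).Finite := by
  have hinj : Function.Injective (List.map (fun i : ℕ+ => (i : ℕ))) :=
    List.map_injective_iff.2 PNat.coe_injective
  refine Set.Finite.of_finite_image (f := List.map (fun i : ℕ+ => (i : ℕ))) ?_ hinj.injOn
  refine ((List.finite_length_eq (Fin (m + 1)) n).image (List.map Fin.val)).subset ?_
  rintro _ ⟨w, ⟨-, hn, hm⟩, rfl⟩
  refine ⟨w.map (fun i : ℕ+ => Fin.ofNat (m + 1) (i : ℕ)), by simp [hn], ?_⟩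
  rw [List.map_map]
  refine List.map_congr_left fun i hi => ?_
  simpa [Fin.ofNat] using hm i hi

/-- `c_{n,m}(u)`: the number of words in `C(u)` of length `n` with maximum at most `m`. -/
noncomputable def centralizerCount (n m : ℕ) (u : List ℕ+) : ℕ :=
  (boundedCentralizer n m u).ncard

/-! Read each `i + 1` as an opening and each `i` as a closing parenthesis. The unmatched letters
form `i^p (i+1)^q`. Raising every unmatched `i`, or lowering every unmatched `i + 1`, is an extremal
crystal operator, and both respect Knuth equivalence. Comparing the unmatched counts of the two
sides of `uw ≡ wu` gives `q = 0` on `C(i)` and `p = 0` on `C(i+1)`. There the two operators are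
mutually inverse and carry one centralizer to the other, keeping length and, for `i + 1 ≤ m`, the
bound `m`. Induction on `u` then reaches `C(1)`. If all letters of `w` are below `u`, lowering fixes
`w`, and descent on `u` forces `w` to be empty. -/

namespace KnuthEquiv

theorem append_both {v w : List ℕ+} (h : KnuthEquiv v w) (x y : List ℕ+) :
    KnuthEquiv (x ++ v ++ y) (x ++ w ++ y) := by
  induction h with
  | rel v w h =>
    refine .rel _ _ ?_
    cases h with
    | acb x' y' a b c hab hbc =>
      simpa using KnuthTransposition.acb (x ++ x') (y' ++ y) a b c hab hbc
    | bac x' y' a b c hab hbc =>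
      simpa using KnuthTransposition.bac (x ++ x') (y' ++ y) a b c hab hbc
  | refl v => exact .refl _
  | symm v w _ ih => exact ih.symm
  | trans u v w _ _ ih₁ ih₂ => exact ih₁.trans _ _ _ ih₂

theorem acb {a b c : ℕ+} (hab : a ≤ b) (hbc : b < c) : KnuthEquiv [a, c, b] [c, a, b] :=
  .rel _ _ (KnuthTransposition.acb [] [] a b c hab hbc)

theorem bac {a b c : ℕ+} (hab : a < b) (hbc : b ≤ c) : KnuthEquiv [b, a, c] [b, c, a] :=
  .rel _ _ (KnuthTransposition.bac [] [] a b c hab hbc)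

/-- An equivalence relation that contains both kinds of Knuth transpositions contains Knuth
equivalence. -/
theorem lift {P : List ℕ+ → List ℕ+ → Prop} (hP : Equivalence P)
    (hacb : ∀ x y a b c, a ≤ b → b < c → P (x ++ [a, c, b] ++ y) (x ++ [c, a, b] ++ y))
    (hbac : ∀ x y a b c, a < b → b ≤ c → P (x ++ [b, a, c] ++ y) (x ++ [b, c, a] ++ y))
    {v w : List ℕ+} (h : KnuthEquiv v w) : P v w := by
  induction h with
  | rel v w h =>
    cases h with
    | acb x y a b c hab hbc => exact hacb x y a b c hab hbc
    | bac x y a b c hab hbc => exact hbac x y a b c hab hbc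
  | refl v => exact hP.refl v
  | symm v w _ ih => exact hP.symm ih
  | trans u v w _ _ ih₁ ih₂ => exact hP.trans ih₁ ih₂

end KnuthEquiv

/-! ### Parenthesis matching and the extremal crystal operators -/

/-- Match letters `i + 1` with later letters `i` as parentheses, reading from the left with `s`
letters `i + 1` already open: the number of letters `i + 1` open at the end. -/
def openUpper (i : ℕ+) : ℕ → List ℕ+ → ℕ
  | s, [] => s
  | s, a :: w =>
    if a = i then openUpper i (s - 1) w
    else if a = i + 1 then openUpper i (s + 1) w
    else openUpper i s w

/-- Replace every unmatched `i` by `i + 1`, when `s` letters `i + 1` are open at the start. -/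
def raiseUnmatched (i : ℕ+) : ℕ → List ℕ+ → List ℕ+
  | _, [] => []
  | s, a :: w =>
    if a = i then (if s = 0 then i + 1 else i) :: raiseUnmatched i (s - 1) w
    else if a = i + 1 then (i + 1) :: raiseUnmatched i (s + 1) w
    else a :: raiseUnmatched i s w

/-- Match letters `i` with earlier letters `i + 1` as parentheses, reading from the right with `s`
letters `i` already open: the number of letters `i` open at the end. -/
def openLower (i : ℕ+) (s : ℕ) : List ℕ+ → ℕ
  | [] => s
  | a :: w =>
    if a = i then openLower i s w + 1
    else if a = i + 1 then openLower i s w - 1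
    else openLower i s w

/-- Replace every unmatched `i + 1` by `i`, when `s` letters `i` are open at the right end. -/
def lowerUnmatched (i : ℕ+) (s : ℕ) : List ℕ+ → List ℕ+
  | [] => []
  | a :: w =>
    (if a = i + 1 ∧ openLower i s w = 0 then i else a) :: lowerUnmatched i s w

section

variable (i : ℕ+)

theorem openUpper_append (s : ℕ) (x y : List ℕ+) :
    openUpper i s (x ++ y) = openUpper i (openUpper i s x) y := by
  induction x generalizing s with
  | nil => rfl
  | cons a x ih => simp only [List.cons_append, openUpper]; split_ifs <;> apply ih

theorem raiseUnmatched_append (s : ℕ) (x y : List ℕ+) :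
    raiseUnmatched i s (x ++ y) =
      raiseUnmatched i s x ++ raiseUnmatched i (openUpper i s x) y := by
  induction x generalizing s with
  | nil => rfl
  | cons a x ih =>
    simp only [List.cons_append, openUpper, raiseUnmatched]; split_ifs <;> simp [ih]

theorem openLower_append (s : ℕ) (x y : List ℕ+) :
    openLower i s (x ++ y) = openLower i (openLower i s y) x := by
  induction x with
  | nil => rfl
  | cons a x ih => simp only [List.cons_append, openLower, ih]

theorem lowerUnmatched_append (s : ℕ) (x y : List ℕ+) :
    lowerUnmatched i s (x ++ y) =
      lowerUnmatched i (openLower i s y) x ++ lowerUnmatched i s y := by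
  induction x with
  | nil => rfl
  | cons a x ih => simp only [List.cons_append, lowerUnmatched, ih, openLower_append]

theorem length_raiseUnmatched (s : ℕ) (w : List ℕ+) :
    (raiseUnmatched i s w).length = w.length := by
  induction w generalizing s with
  | nil => rfl
  | cons a w ih => simp only [raiseUnmatched]; split_ifs <;> simp [ih]

theorem length_lowerUnmatched (s : ℕ) (w : List ℕ+) :
    (lowerUnmatched i s w).length = w.length := by
  induction w with
  | nil => rfl
  | cons a w ih => simp [lowerUnmatched, ih]

variable {i}

theorem le_of_mem_raiseUnmatched {m : ℕ+} (hm : i + 1 ≤ m) {s : ℕ} {w : List ℕ+}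
    (hw : ∀ a ∈ w, a ≤ m) : ∀ a ∈ raiseUnmatched i s w, a ≤ m := by
  have hi : i ≤ m := (PNat.lt_add_right i 1).le.trans hm
  induction w generalizing s with
  | nil => simp [raiseUnmatched]
  | cons b w ih =>
    have hb := hw b (by simp)
    have ih' (s) := ih (s := s) fun a ha => hw a (by simp [ha])
    simp only [raiseUnmatched]
    split_ifs <;> simp only [List.mem_cons, forall_eq_or_imp] <;> exact ⟨by assumption, ih' _⟩

theorem le_of_mem_lowerUnmatched {m : ℕ+} (hm : i ≤ m) {s : ℕ} {w : List ℕ+}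
    (hw : ∀ a ∈ w, a ≤ m) : ∀ a ∈ lowerUnmatched i s w, a ≤ m := by
  induction w with
  | nil => simp [lowerUnmatched]
  | cons b w ih =>
    have hb := hw b (by simp)
    have ih' := ih fun a ha => hw a (by simp [ha])
    simp only [lowerUnmatched]
    split_ifs <;> simp only [List.mem_cons, forall_eq_or_imp] <;> exact ⟨by assumption, ih'⟩

/-- The first `s` closings consumed by the initial openings stay `i` and have no partner inside the
word, hence the count `s`. Carrying a general `s` lets the induction strip the first letter. -/
theorem lower_raiseUnmatched {s : ℕ} {w : List ℕ+} (h : openUpper i s w = 0) :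
    openLower i 0 (raiseUnmatched i s w) = s ∧
      lowerUnmatched i 0 (raiseUnmatched i s w) = w := by
  have hne : i + 1 ≠ i := (PNat.lt_add_right i 1).ne'
  induction w generalizing s with
  | nil => exact ⟨h.symm, rfl⟩
  | cons a w ih =>
    simp only [openUpper] at h
    simp only [raiseUnmatched]
    rcases eq_or_ne a i with rfl | hi
    · rcases s with _ | s
      · obtain ⟨h3, h4⟩ := ih (by simpa using h)
        simp [openLower, lowerUnmatched, hne, h3, h4]
      · obtain ⟨h3, h4⟩ := ih (by simpa using h)
        simp [openLower, lowerUnmatched, h3, h4, hne.symm]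
    rcases eq_or_ne a (i + 1) with rfl | hj
    · obtain ⟨h3, h4⟩ := ih (by simpa [hne] using h)
      simp [openLower, lowerUnmatched, hne, h3, h4]
    · obtain ⟨h3, h4⟩ := ih (by simpa [hi, hj] using h)
      simp [openLower, lowerUnmatched, hi, hj, h3, h4]

theorem raise_lowerUnmatched (w : List ℕ+) :
    openUpper i (openLower i 0 w) (lowerUnmatched i 0 w) = 0 ∧
      raiseUnmatched i (openLower i 0 w) (lowerUnmatched i 0 w) = w := by
  have hne : i + 1 ≠ i := (PNat.lt_add_right i 1).ne'
  induction w with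
  | nil => exact ⟨rfl, rfl⟩
  | cons a w ih =>
    obtain ⟨h1, h2⟩ := ih
    simp only [lowerUnmatched, openLower]
    rcases eq_or_ne a i with rfl | hi
    · simp [hne.symm, openUpper, raiseUnmatched, h1, h2]
    rcases eq_or_ne a (i + 1) with rfl | hj
    · rcases h0 : openLower i 0 w with _ | k
      · rw [h0] at h1 h2
        simp [hne, openUpper, raiseUnmatched, h1, h2]
      · rw [h0] at h1 h2
        simp [hne, openUpper, raiseUnmatched, h1, h2]
    · simp [hi, hj, openUpper, raiseUnmatched, h1, h2]

/-! ### Compatibility with Knuth transpositions -/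

/-- The order of `a` and `c` matters only if `a = i` and `c = i + 1`. Then `b = i`, and this closing
absorbs the extra opening that truncation at `s = 0` could leave. -/
theorem openUpper_acb (s : ℕ) {a b c : ℕ+} (hab : a ≤ b) (hbc : b < c) :
    openUpper i s [a, c, b] = openUpper i s [c, a, b] := by
  have h0 : i < i + 1 := PNat.lt_add_right i 1
  have hb := le_or_gt b i
  rw [← PNat.add_one_le_iff] at hb
  simp only [openUpper]
  rcases hb with hb | hb <;> split_ifs <;>
    first | rfl | (exfalso; order)

theorem openUpper_bac (s : ℕ) {a b c : ℕ+} (hab : a < b) (hbc : b ≤ c) :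
    openUpper i s [b, a, c] = openUpper i s [b, c, a] := by
  have h0 : i < i + 1 := PNat.lt_add_right i 1
  have hb := le_or_gt b i
  rw [← PNat.add_one_le_iff] at hb
  simp only [openUpper]
  rcases hb with hb | hb <;> split_ifs <;>
    first | rfl | (exfalso; order)

theorem openLower_acb (s : ℕ) {a b c : ℕ+} (hab : a ≤ b) (hbc : b < c) :
    openLower i s [a, c, b] = openLower i s [c, a, b] := by
  have h0 : i < i + 1 := PNat.lt_add_right i 1
  have hb := le_or_gt b i
  rw [← PNat.add_one_le_iff] at hb
  simp only [openLower]
  rcases hb with hb | hb <;> split_ifs <;>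
    first | rfl | (exfalso; order)

theorem openLower_bac (s : ℕ) {a b c : ℕ+} (hab : a < b) (hbc : b ≤ c) :
    openLower i s [b, a, c] = openLower i s [b, c, a] := by
  have h0 : i < i + 1 := PNat.lt_add_right i 1
  have hb := le_or_gt b i
  rw [← PNat.add_one_le_iff] at hb
  simp only [openLower]
  rcases hb with hb | hb <;> split_ifs <;>
    first | rfl | (exfalso; order)

theorem lt_or_eq_or_eq_succ_or_gt (i x : ℕ+) :
    (x < i ∧ x ≠ i ∧ x ≠ i + 1) ∨ x = i ∨ x = i + 1 ∨ (i + 1 < x ∧ x ≠ i ∧ x ≠ i + 1) := by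
  have h0 : i < i + 1 := PNat.lt_add_right i 1
  rcases lt_trichotomy x i with h | h | h
  · exact .inl ⟨h, by order, by order⟩
  · exact .inr (.inl h)
  · rcases (PNat.add_one_le_iff.2 h).eq_or_lt with h | h
    · exact .inr (.inr (.inl h.symm))
    · exact .inr (.inr (.inr ⟨h, by order, by order⟩))

set_option maxHeartbeats 4000000 in
theorem raiseUnmatched_acb (s : ℕ) {a b c : ℕ+} (hab : a ≤ b) (hbc : b < c) :
    KnuthEquiv (raiseUnmatched i s [a, c, b]) (raiseUnmatched i s [c, a, b]) := by
  have h0 : i < i + 1 := PNat.lt_add_right i 1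
  have h1 := h0.ne
  have h2 := h0.ne'
  rcases lt_or_eq_or_eq_succ_or_gt i a with
    ⟨ha, _, _⟩ | ha | ha | ⟨ha, _, _⟩ <;>
  rcases lt_or_eq_or_eq_succ_or_gt i b with
    ⟨hb, _, _⟩ | hb | hb | ⟨hb, _, _⟩ <;>
  try (exfalso; order)
  all_goals
    rcases lt_or_eq_or_eq_succ_or_gt i c with
      ⟨hc, _, _⟩ | hc | hc | ⟨hc, _, _⟩ <;>
    try (exfalso; order)
  all_goals
    -- At most two of the letters equal `i`, so any `s ≥ 2` matches them all.
    rcases s with _ | _ | s <;> simp [raiseUnmatched, *] <;>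
    first
    | exact .refl _
    | (refine .acb ?_ ?_ <;> order)
    | (refine .bac ?_ ?_ <;> order)
    -- The type can change: for `a = b = i`, `c = i + 1`, `s = 0` the images are `(i+1)(i+1)i` and
    -- `(i+1)i(i+1)`.
    | (refine .symm _ _ (KnuthEquiv.bac ?_ ?_) <;> order)

set_option maxHeartbeats 4000000 in
theorem raiseUnmatched_bac (s : ℕ) {a b c : ℕ+} (hab : a < b) (hbc : b ≤ c) :
    KnuthEquiv (raiseUnmatched i s [b, a, c]) (raiseUnmatched i s [b, c, a]) := by
  have h0 : i < i + 1 := PNat.lt_add_right i 1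
  have h1 := h0.ne
  have h2 := h0.ne'
  rcases lt_or_eq_or_eq_succ_or_gt i a with
    ⟨ha, _, _⟩ | ha | ha | ⟨ha, _, _⟩ <;>
  rcases lt_or_eq_or_eq_succ_or_gt i b with
    ⟨hb, _, _⟩ | hb | hb | ⟨hb, _, _⟩ <;>
  try (exfalso; order)
  all_goals
    rcases lt_or_eq_or_eq_succ_or_gt i c with
      ⟨hc, _, _⟩ | hc | hc | ⟨hc, _, _⟩ <;>
    try (exfalso; order)
  all_goals
    rcases s with _ | _ | s <;> simp [raiseUnmatched, *] <;>
    first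
    | exact .refl _
    | (refine .bac ?_ ?_ <;> order)

set_option maxHeartbeats 4000000 in
theorem lowerUnmatched_acb (s : ℕ) {a b c : ℕ+} (hab : a ≤ b) (hbc : b < c) :
    KnuthEquiv (lowerUnmatched i s [a, c, b]) (lowerUnmatched i s [c, a, b]) := by
  have h0 : i < i + 1 := PNat.lt_add_right i 1
  have h1 := h0.ne
  have h2 := h0.ne'
  rcases lt_or_eq_or_eq_succ_or_gt i a with
    ⟨ha, _, _⟩ | ha | ha | ⟨ha, _, _⟩ <;>
  rcases lt_or_eq_or_eq_succ_or_gt i b with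
    ⟨hb, _, _⟩ | hb | hb | ⟨hb, _, _⟩ <;>
  try (exfalso; order)
  all_goals
    rcases lt_or_eq_or_eq_succ_or_gt i c with
      ⟨hc, _, _⟩ | hc | hc | ⟨hc, _, _⟩ <;>
    try (exfalso; order)
  all_goals
    rcases s with _ | _ | s <;> simp [lowerUnmatched, openLower, *] <;>
    first
    | exact .refl _
    | (refine .acb ?_ ?_ <;> order)

set_option maxHeartbeats 4000000 in
theorem lowerUnmatched_bac (s : ℕ) {a b c : ℕ+} (hab : a < b) (hbc : b ≤ c) :
    KnuthEquiv (lowerUnmatched i s [b, a, c]) (lowerUnmatched i s [b, c, a]) := by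
  have h0 : i < i + 1 := PNat.lt_add_right i 1
  have h1 := h0.ne
  have h2 := h0.ne'
  rcases lt_or_eq_or_eq_succ_or_gt i a with
    ⟨ha, _, _⟩ | ha | ha | ⟨ha, _, _⟩ <;>
  rcases lt_or_eq_or_eq_succ_or_gt i b with
    ⟨hb, _, _⟩ | hb | hb | ⟨hb, _, _⟩ <;>
  try (exfalso; order)
  all_goals
    rcases lt_or_eq_or_eq_succ_or_gt i c with
      ⟨hc, _, _⟩ | hc | hc | ⟨hc, _, _⟩ <;>
    try (exfalso; order)
  all_goals
    rcases s with _ | _ | s <;> simp [lowerUnmatched, openLower, *] <;>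
    first
    | exact .refl _
    | (refine .acb ?_ ?_ <;> order)
    | (refine .bac ?_ ?_ <;> order)
    | (refine .symm _ _ (KnuthEquiv.acb ?_ ?_) <;> order)

theorem KnuthEquiv.openUpper_eq {v w : List ℕ+} (h : KnuthEquiv v w) (s : ℕ) :
    openUpper i s v = openUpper i s w := by
  refine h.lift (P := fun v w => openUpper i s v = openUpper i s w)
    ⟨fun _ => rfl, Eq.symm, Eq.trans⟩ ?_ ?_ <;> intro x y a b c hab hbc
  · simp only [openUpper_append, openUpper_acb _ hab hbc]
  · simp only [openUpper_append, openUpper_bac _ hab hbc]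

theorem KnuthEquiv.openLower_eq {v w : List ℕ+} (h : KnuthEquiv v w) (s : ℕ) :
    openLower i s v = openLower i s w := by
  refine h.lift (P := fun v w => openLower i s v = openLower i s w)
    ⟨fun _ => rfl, Eq.symm, Eq.trans⟩ ?_ ?_ <;> intro x y a b c hab hbc
  · simp only [openLower_append, openLower_acb _ hab hbc]
  · simp only [openLower_append, openLower_bac _ hab hbc]

theorem KnuthEquiv.raiseUnmatched {v w : List ℕ+} (h : KnuthEquiv v w) (s : ℕ) :
    KnuthEquiv (raiseUnmatched i s v) (raiseUnmatched i s w) := by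
  refine h.lift (P := fun v w => KnuthEquiv (_root_.raiseUnmatched i s v)
    (_root_.raiseUnmatched i s w))
    ⟨fun _ => .refl _, fun h => h.symm, fun h h' => h.trans _ _ _ h'⟩ ?_ ?_ <;>
    intro x y a b c hab hbc
  · simp only [raiseUnmatched_append, openUpper_append, openUpper_acb _ hab hbc]
    exact (raiseUnmatched_acb _ hab hbc).append_both _ _
  · simp only [raiseUnmatched_append, openUpper_append, openUpper_bac _ hab hbc]
    exact (raiseUnmatched_bac _ hab hbc).append_both _ _

theorem KnuthEquiv.lowerUnmatched {v w : List ℕ+} (h : KnuthEquiv v w) (s : ℕ) :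
    KnuthEquiv (lowerUnmatched i s v) (lowerUnmatched i s w) := by
  refine h.lift (P := fun v w => KnuthEquiv (_root_.lowerUnmatched i s v)
    (_root_.lowerUnmatched i s w))
    ⟨fun _ => .refl _, fun h => h.symm, fun h h' => h.trans _ _ _ h'⟩ ?_ ?_ <;>
    intro x y a b c hab hbc
  · simp only [List.append_assoc, lowerUnmatched_append i _ x, lowerUnmatched_append i _ _ y,
      openLower_append, openLower_acb _ hab hbc]
    simpa using (lowerUnmatched_acb _ hab hbc).append_both _ _
  · simp only [List.append_assoc, lowerUnmatched_append i _ x, lowerUnmatched_append i _ _ y,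
      openLower_append, openLower_bac _ hab hbc]
    simpa using (lowerUnmatched_bac _ hab hbc).append_both _ _

/-! ### Centralizers of single letters -/

theorem openUpper_eq_zero_of_mem {w : List ℕ+} (hw : w ∈ placticCentralizer [i]) :
    openUpper i 0 w = 0 := by
  have h := KnuthEquiv.openUpper_eq (i := i) hw 0
  simp only [openUpper_append, openUpper, if_true, Nat.zero_sub] at h
  -- With truncated subtraction, `x = x - 1` forces `x = 0`.
  omega

theorem openLower_eq_zero_of_mem {w : List ℕ+} (hw : w ∈ placticCentralizer [i + 1]) :
    openLower i 0 w = 0 := by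
  have hne : i + 1 ≠ i := (PNat.lt_add_right i 1).ne'
  have h := KnuthEquiv.openLower_eq (i := i) hw 0
  simp only [openLower_append, openLower, if_true, hne, if_false, Nat.zero_sub] at h
  omega

/-- Since `w` leaves nothing open, the extra `i` is unmatched at either end and becomes `i + 1`
without altering how `w` is raised. -/
theorem raiseUnmatched_mem {w : List ℕ+} (hw : w ∈ placticCentralizer [i]) :
    raiseUnmatched i 0 w ∈ placticCentralizer [i + 1] := by
  have h := KnuthEquiv.raiseUnmatched (i := i) hw 0
  change KnuthEquiv _ _
  simpa [raiseUnmatched_append, raiseUnmatched, openUpper, openUpper_eq_zero_of_mem hw] using h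

theorem lowerUnmatched_mem {w : List ℕ+} (hw : w ∈ placticCentralizer [i + 1]) :
    lowerUnmatched i 0 w ∈ placticCentralizer [i] := by
  have hne : i + 1 ≠ i := (PNat.lt_add_right i 1).ne'
  have h := KnuthEquiv.lowerUnmatched (i := i) hw 0
  change KnuthEquiv _ _
  simpa [lowerUnmatched_append, lowerUnmatched, openLower, hne, openLower_eq_zero_of_mem hw]
    using h

theorem lowerUnmatched_eq_self {s : ℕ} {w : List ℕ+} (hw : i + 1 ∉ w) :
    lowerUnmatched i s w = w := by
  induction w with
  | nil => rfl
  | cons a w ih =>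
    simp only [List.mem_cons, not_or] at hw
    simp [lowerUnmatched, ih hw.2, Ne.symm hw.1]

theorem not_mem_of_openLower_eq_zero {w : List ℕ+} (hw : i + 1 ∉ w)
    (h : openLower i 0 w = 0) : i ∉ w := by
  induction w with
  | nil => simp
  | cons a w ih =>
    simp only [List.mem_cons, not_or] at hw ⊢
    simp only [openLower, Ne.symm hw.1, if_false] at h
    split_ifs at h with ha
    exact ⟨Ne.symm ha, ih hw.2 h⟩

end

/-! ### Counting -/

theorem centralizerCount_succ {n m : ℕ} {i : ℕ+} (hm : (i : ℕ) + 1 ≤ m) :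
    centralizerCount n m [i + 1] = centralizerCount n m [i] := by
  obtain ⟨m, rfl⟩ : ∃ k : ℕ+, m = k := ⟨⟨m, by omega⟩, rfl⟩
  have hi : i + 1 ≤ m := by rw [← PNat.coe_le_coe]; simpa using hm
  have hi' : i ≤ m := (PNat.lt_add_right i 1).le.trans hi
  apply le_antisymm
  · refine Set.ncard_le_ncard_of_injOn (lowerUnmatched i 0) ?_ ?_
      (boundedCentralizer_finite _ _ _)
    · rintro w ⟨hw, hn, hwm⟩
      exact ⟨lowerUnmatched_mem hw, by rw [length_lowerUnmatched, hn],
        le_of_mem_lowerUnmatched hi' hwm⟩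
    · refine Set.LeftInvOn.injOn (f₁' := raiseUnmatched i 0) ?_
      rintro w ⟨hw, -, -⟩
      -- The inverse starts from `openLower i 0 w` openings, which is `0` on `C(i+1)`.
      simpa [openLower_eq_zero_of_mem hw] using (raise_lowerUnmatched (i := i) w).2
  · refine Set.ncard_le_ncard_of_injOn (raiseUnmatched i 0) ?_ ?_
      (boundedCentralizer_finite _ _ _)
    · rintro w ⟨hw, hn, hwm⟩
      exact ⟨raiseUnmatched_mem hw, by rw [length_raiseUnmatched, hn],
        le_of_mem_raiseUnmatched hi hwm⟩
    · refine Set.LeftInvOn.injOn (f₁' := lowerUnmatched i 0) ?_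
      rintro w ⟨hw, -, -⟩
      exact (lower_raiseUnmatched (openUpper_eq_zero_of_mem hw)).2

/-- For `u = i + 1`, no `i` in `w` can be matched and none may be unmatched, so `i` is absent too.
Thus `w` lies in `C(i)` with all letters below `i`. -/
theorem eq_nil_of_mem_placticCentralizer {u : ℕ+} {w : List ℕ+}
    (hw : w ∈ placticCentralizer [u]) (hlt : ∀ a ∈ w, a < u) : w = [] := by
  induction u using PNat.recOn with
  | one => exact List.eq_nil_iff_forall_not_mem.2 fun a ha => not_lt_one (hlt a ha)
  | succ i ih =>
    have hj : i + 1 ∉ w := fun h => (hlt _ h).false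
    have hi := not_mem_of_openLower_eq_zero hj (openLower_eq_zero_of_mem hw)
    have hw' := lowerUnmatched_mem hw
    rw [lowerUnmatched_eq_self hj] at hw'
    refine ih hw' fun a ha => lt_of_le_of_ne (PNat.lt_add_one_iff.1 (hlt a ha)) ?_
    rintro rfl
    exact hi ha

theorem mainTheorem8 (n m : ℕ) (u : ℕ+) :
    ((u : ℕ) ≤ m → centralizerCount n m [u] = centralizerCount n m [1]) ∧
      (m < (u : ℕ) → centralizerCount n m [u] = if n = 0 then 1 else 0) := by
  constructor
  · induction u using PNat.recOn with
    | one => exact fun _ => rfl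
    | succ i ih =>
      intro h
      rw [PNat.add_coe, PNat.one_coe] at h
      rw [centralizerCount_succ h, ih (by omega)]
  · intro h
    have hnil {w : List ℕ+} (hw : w ∈ boundedCentralizer n m [u]) : w = [] :=
      eq_nil_of_mem_placticCentralizer hw.1 fun a ha =>
        PNat.coe_lt_coe _ _ |>.1 ((hw.2.2 a ha).trans_lt h)
    unfold centralizerCount
    split_ifs with hn
    · subst hn
      rw [Set.ncard_eq_one]
      refine ⟨[], Set.eq_singleton_iff_unique_mem.2 ⟨⟨?_, rfl, by simp⟩, fun w => hnil⟩⟩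
      exact .refl _
    · rw [Set.ncard_eq_zero (boundedCentralizer_finite _ _ _), Set.eq_empty_iff_forall_notMem]
      intro w hw
      exact hn (by rw [← hw.2.1, hnil hw, List.length_nil])
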